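/- All graphs are finite and simple. A diamond is the graph $K_4-e$. Let $G\neq K_4$ be a connected claw-free (no induced $K_{1,3}$) cubic graph. Then the vertex set of $G$ has a unique partition into sets each of which induces a triangle or a diamond in $G$; let $u(G)$ be the number of sets (units) in this partition. Let $m(G,2)$ be the $2$-percolation number of $G$, that is, the minimum cardinality of a set $S\subseteq V(G)$ such that, starting with exactly the vertices of $S$ infected and repeatedly infecting every vertex that has at least two infected neighbors, all vertices of $G$ are eventually infected. For $k\ge 2$ let the diamond-necklace $N_k$ be the graph obtained from $k$ disjoint diamonds $D_1,\dots,D_k$, where $V(D_i)=\{a_i,b_i,c_i,d_i\}$ and $a_ib_i$ is the missing edge of $D_i$, by adding the edges $a_ib_{i+1}$ for $1\le i\le k-1$ and the edge $a_kb_1$. Then $$m(G,2)=\begin{cases}u(G)+1 & \text{if } G\cong N_k \text{ for some } k\ge 2,\\ u(G) & \text{otherwise.}\end{cases}$$ -/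

import Mathlib

namespace SpreadingGraphs

/-- The diamond `K₄ - e` on the vertices `a = 0`, `b = 1`, `c = 2`, `d = 3`; the missing edge
is `ab`. -/
def diamond : SimpleGraph (Fin 4) :=
  (⊤ : SimpleGraph (Fin 4)).deleteEdges {s(0, 1)}

/-- The diamond-necklace `N_k` (meant for `k ≥ 2`): `k` disjoint diamonds `D_i` with vertices
`(i, 0) = a_i`, `(i, 1) = b_i`, `(i, 2) = c_i`, `(i, 3) = d_i`, where `i` runs cyclically through
`ZMod k`, and the additional edges `a_i b_{i+1}`. -/
def diamondNecklace (k : ℕ) : SimpleGraph (ZMod k × Fin 4) where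
  Adj p q :=
    (p.1 = q.1 ∧ diamond.Adj p.2 q.2) ∨
    (q.1 = p.1 + 1 ∧ p.2 = 0 ∧ q.2 = 1) ∨
    (p.1 = q.1 + 1 ∧ q.2 = 0 ∧ p.2 = 1)
  symm := ⟨by
    rintro p q (⟨h, h'⟩ | h | h)
    · exact Or.inl ⟨h.symm, h'.symm⟩
    · exact Or.inr (Or.inr h)
    · exact Or.inr (Or.inl h)⟩
  loopless := ⟨by
    rintro p (⟨_, h⟩ | ⟨_, h, h'⟩ | ⟨_, h, h'⟩)
    · exact diamond.irrefl h
    · rw [h] at h'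
      exact absurd h' (by decide)
    · rw [h] at h'
      exact absurd h' (by decide)⟩

variable {V : Type*}

/-- `G` is (isomorphic to) a diamond-necklace `N_k` with `k ≥ 2`. -/
def IsDiamondNecklace (G : SimpleGraph V) : Prop :=
  ∃ k : ℕ, 2 ≤ k ∧ Nonempty (G ≃g diamondNecklace k)

/-- `G` has no induced subgraph isomorphic to `K_{1,3}`. -/
def IsClawFree (G : SimpleGraph V) : Prop :=
  ¬ (completeBipartiteGraph (Fin 1) (Fin 3)).IsIndContained G

/-- The set `s` of vertices induces a triangle in `G`. -/
def InducesTriangle (G : SimpleGraph V) (s : Set V) : Prop :=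
  Nonempty (G.induce s ≃g (⊤ : SimpleGraph (Fin 3)))

/-- The set `s` of vertices induces a diamond in `G`. -/
def InducesDiamond (G : SimpleGraph V) (s : Set V) : Prop :=
  Nonempty (G.induce s ≃g diamond)

/-- A triangle-diamond partition: a partition of the vertex set each part of which (each *unit*)
induces a triangle or a diamond. -/
def IsTriangleDiamondPartition [Fintype V] [DecidableEq V] (G : SimpleGraph V)
    (P : Finpartition (Finset.univ : Finset V)) : Prop :=
  ∀ U ∈ P.parts, InducesTriangle G (U : Set V) ∨ InducesDiamond G (U : Set V)

/-- The vertices that are eventually infected in `r`-neighbor bootstrap percolation on `G` started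
from `S`: those of `S`, and any vertex with at least `r` infected neighbors. -/
inductive Infected (G : SimpleGraph V) (r : ℕ) (S : Finset V) : V → Prop
  | init (v : V) (hv : v ∈ S) : Infected G r S v
  | step (v : V) (T : Finset V) (hcard : r ≤ T.card) (hadj : ∀ u ∈ T, G.Adj v u)
      (hinf : ∀ u ∈ T, Infected G r S u) : Infected G r S v

/-- `S` is an `r`-percolating set of `G`: every vertex is eventually infected. -/
def IsPercolatingSet (G : SimpleGraph V) (r : ℕ) (S : Finset V) : Prop :=
  ∀ v, Infected G r S v

/-- The `r`-percolation number `m(G, r)` of a finite graph: the minimum cardinality of an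
`r`-percolating set (the set of all vertices is one, so the minimum is attained). -/
noncomputable def percolationNumber (G : SimpleGraph V) (r : ℕ) : ℕ :=
  sInf {n | ∃ S : Finset V, IsPercolatingSet G r S ∧ S.card = n}

end SpreadingGraphs

namespace SpreadingGraphs

variable {V : Type*} {G : SimpleGraph V}

/-! In a cubic graph a vertex has two neighbours inside its unit, hence at most one outside. So a
triangle free of seeds never gets its first infected vertex, and every unit needs a seed
(`IsPercolatingSet.inter_triangle_nonempty`).

Conversely, rank the units by distance from a root. Infection enters a unit at a vertex `e` from a
unit of smaller rank; one seed `t` of the unit, suitably chosen next to `e`, lets `e` and then the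
whole unit become infected (`isPercolatingSet_of_seeds`). Only the root unit may need a second seed.

The extra seed is saved when a triangle unit has a vertex `x` with a non-bridge edge `xy` leaving
it. Root at `y` and delete `xy`: the triangle is then entered elsewhere, so `x` can be its seed, and
`x` also serves as the second seed for the unit of `y`. Such an edge exists as soon as some unit is
a triangle, by taking a smallest side of a bridge (`exists_not_isCutBy`).

If all units are diamonds, a single seed per unit must lie in both triangles of its diamond, so it
has no neighbour outside and nothing spreads (`IsPercolatingSet.card_parts_lt`). The graphs in which
all units are diamonds are exactly the necklaces (`isDiamondNecklace_of_forall_isDia`,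
`IsDiamondNecklace.isDia_of_isUnitSet`). -/

/-- The vertices of `U` form a triangle. -/
def IsTri [DecidableEq V] (G : SimpleGraph V) (U : Finset V) : Prop :=
  ∃ a b c, G.Adj a b ∧ G.Adj a c ∧ G.Adj b c ∧ U = {a, b, c}

/-- The vertices of `U` form an induced diamond. -/
def IsDia [DecidableEq V] (G : SimpleGraph V) (U : Finset V) : Prop :=
  ∃ a b c d, G.Adj a c ∧ G.Adj a d ∧ G.Adj b c ∧ G.Adj b d ∧ G.Adj c d ∧ ¬ G.Adj a b ∧ a ≠ b ∧
    U = {a, b, c, d}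

theorem diamond_adj (i j : Fin 4) :
    diamond.Adj i j ↔ i ≠ j ∧ ¬ (i = 0 ∧ j = 1) ∧ ¬ (i = 1 ∧ j = 0) := by
  simp only [diamond, SimpleGraph.deleteEdges_adj, SimpleGraph.top_adj, Set.mem_singleton_iff,
    Sym2.eq_iff, not_or]

/-- Isomorphisms from a graph to an induced subgraph, as injective maps of vertices. -/
theorem nonempty_induce_iso_iff {W : Type*} (H : SimpleGraph W) (s : Set V) :
    Nonempty (G.induce s ≃g H) ↔
      ∃ f : W → V, Function.Injective f ∧ Set.range f = s ∧ ∀ i j, G.Adj (f i) (f j) ↔ H.Adj i j := by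
  constructor
  · rintro ⟨φ⟩
    refine ⟨fun i => (φ.symm i : V), fun i j h => φ.symm.injective (Subtype.ext h), ?_, ?_⟩
    · ext v
      constructor
      · rintro ⟨i, rfl⟩
        exact (φ.symm i).2
      · intro hv
        exact ⟨φ ⟨v, hv⟩, by simp⟩
    · intro i j
      exact φ.symm.map_rel_iff (a := i) (b := j)
  · rintro ⟨f, hf, rfl, h⟩
    refine ⟨SimpleGraph.Iso.symm ⟨Equiv.ofInjective f hf, ?_⟩⟩
    intro i j
    exact h i j

theorem inducesTriangle_iff [DecidableEq V] (U : Finset V) :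
    InducesTriangle G (U : Set V) ↔ IsTri G U := by
  rw [InducesTriangle, nonempty_induce_iso_iff]
  constructor
  · rintro ⟨f, -, hr, h⟩
    refine ⟨f 0, f 1, f 2, (h _ _).2 (by decide), (h _ _).2 (by decide), (h _ _).2 (by decide), ?_⟩
    ext v
    rw [← Finset.mem_coe, ← hr]
    simp [Fin.exists_fin_succ, eq_comm]
  · rintro ⟨a, b, c, hab, hac, hbc, rfl⟩
    have := hab.ne; have := hac.ne; have := hbc.ne
    refine ⟨![a, b, c], ?_, ?_, ?_⟩
    · intro i j
      fin_cases i <;> fin_cases j <;> simp <;> grind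
    · ext v
      simp only [Set.mem_range, Fin.exists_fin_succ]
      simp [eq_comm]
    · intro i j
      fin_cases i <;> fin_cases j <;> simp [hab, hac, hbc, hab.symm, hac.symm, hbc.symm]

theorem inducesDiamond_iff [DecidableEq V] (U : Finset V) :
    InducesDiamond G (U : Set V) ↔ IsDia G U := by
  rw [InducesDiamond, nonempty_induce_iso_iff]
  constructor
  · rintro ⟨f, hf, hr, h⟩
    simp only [diamond_adj] at h
    refine ⟨f 0, f 1, f 2, f 3, (h _ _).2 (by decide), (h _ _).2 (by decide), (h _ _).2 (by decide),
      (h _ _).2 (by decide), (h _ _).2 (by decide), by rw [h]; decide,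
      fun h => absurd (hf h) (by decide), ?_⟩
    ext v
    rw [← Finset.mem_coe, ← hr]
    simp [Fin.exists_fin_succ, eq_comm]
  · rintro ⟨a, b, c, d, hac, had, hbc, hbd, hcd, hab, hne, rfl⟩
    have := hac.ne; have := had.ne; have := hbc.ne; have := hbd.ne; have := hcd.ne
    have hba : ¬ G.Adj b a := fun h => hab h.symm
    refine ⟨![a, b, c, d], ?_, ?_, ?_⟩
    · intro i j
      fin_cases i <;> fin_cases j <;> simp <;> grind
    · ext v
      simp only [Set.mem_range, Fin.exists_fin_succ]
      simp [eq_comm]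
    · intro i j
      rw [diamond_adj]
      fin_cases i <;> fin_cases j <;> simp [hab, hba, hac, hbc, had, hbd, hcd, hac.symm, hbc.symm,
        had.symm, hbd.symm, hcd.symm]

theorem IsDia.card_eq [DecidableEq V] {D : Finset V} (hD : IsDia G D) : D.card = 4 := by
  obtain ⟨a, b, c, d, hac, had, hbc, hbd, hcd, hab, hne, rfl⟩ := hD
  rw [Finset.card_insert_of_notMem, Finset.card_eq_three.2 ⟨b, c, d, hbc.ne, hbd.ne, hcd.ne, rfl⟩]
  simp [hne, hac.ne, had.ne]

theorem IsTri.card_eq [DecidableEq V] {T : Finset V} (hT : IsTri G T) : T.card = 3 := by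
  obtain ⟨x, y, z, hxy, hxz, hyz, rfl⟩ := hT
  exact Finset.card_eq_three.2 ⟨x, y, z, hxy.ne, hxz.ne, hyz.ne, rfl⟩

theorem isTriangleDiamondPartition_iff [Fintype V] [DecidableEq V]
    (P : Finpartition (Finset.univ : Finset V)) :
    IsTriangleDiamondPartition G P ↔ ∀ U ∈ P.parts, IsTri G U ∨ IsDia G U := by
  simp only [IsTriangleDiamondPartition, inducesTriangle_iff, inducesDiamond_iff]

/-- A set closed under adjacency in a connected graph contains all vertices. -/
theorem mem_of_closed (hconn : G.Connected) {C : Set V} {r : V} (hr : r ∈ C)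
    (hC : ∀ x y, x ∈ C → G.Adj x y → y ∈ C) (v : V) : v ∈ C := by
  obtain ⟨w⟩ := hconn.preconnected r v
  induction w with
  | nil => exact hr
  | cons h _ ih => exact ih (hC _ _ hr h)

/-! ### Local structure of cubic graphs and the unique partition into units. -/

section Cubic

variable [Fintype V] [DecidableEq V] [DecidableRel G.Adj]

theorem eq_of_adj_of_three (hcubic : G.IsRegularOfDegree 3) {v a b c : V} (ha : G.Adj v a)
    (hb : G.Adj v b) (hc : G.Adj v c) (hab : a ≠ b) (hac : a ≠ c) (hbc : b ≠ c) {x : V}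
    (hx : G.Adj v x) : x = a ∨ x = b ∨ x = c := by
  have hsub : ({a, b, c} : Finset V) ⊆ G.neighborFinset v := by
    intro y hy
    simp only [Finset.mem_insert, Finset.mem_singleton] at hy
    rw [SimpleGraph.mem_neighborFinset]
    rcases hy with rfl | rfl | rfl <;> assumption
  have hcard : (G.neighborFinset v).card ≤ ({a, b, c} : Finset V).card := by
    rw [SimpleGraph.card_neighborFinset_eq_degree, hcubic.degree_eq,
      Finset.card_eq_three.2 ⟨a, b, c, hab, hac, hbc, rfl⟩]
  have := Finset.eq_of_subset_of_card_le hsub hcard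
  have hx' : x ∈ G.neighborFinset v := by simpa using hx
  rw [← this] at hx'
  simpa using hx'

theorem exists_third_neighbor (hcubic : G.IsRegularOfDegree 3) (v a b : V) :
    ∃ c, G.Adj v c ∧ c ≠ a ∧ c ≠ b := by
  by_contra! h
  have hsub : G.neighborFinset v ⊆ {a, b} := by
    intro x hx
    rw [SimpleGraph.mem_neighborFinset] at hx
    have := h x hx
    simp only [Finset.mem_insert, Finset.mem_singleton]
    tauto
  have := (Finset.card_le_card hsub).trans Finset.card_le_two
  rw [SimpleGraph.card_neighborFinset_eq_degree, hcubic.degree_eq] at this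
  omega

/-- The four vertices use up each other's degrees, so the clique has no outgoing edge and is the
whole connected graph. -/
theorem not_four_clique (hconn : G.Connected) (hcubic : G.IsRegularOfDegree 3)
    (hK4 : ¬ Nonempty (G ≃g (⊤ : SimpleGraph (Fin 4)))) {a b c d : V} (hab : G.Adj a b)
    (hac : G.Adj a c) (had : G.Adj a d) (hbc : G.Adj b c) (hbd : G.Adj b d) (hcd : G.Adj c d) :
    False := by
  have := hab.ne; have := hac.ne; have := had.ne; have := hbc.ne; have := hbd.ne; have := hcd.ne
  have hmem : ∀ v, v ∈ ({a, b, c, d} : Set V) := by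
    refine mem_of_closed hconn (r := a) (by simp) ?_
    intro x y hx hxy
    simp only [Set.mem_insert_iff, Set.mem_singleton_iff] at hx ⊢
    rcases hx with rfl | rfl | rfl | rfl
    · have := eq_of_adj_of_three hcubic hab hac had
        (by assumption) (by assumption) (by assumption) hxy
      tauto
    · have := eq_of_adj_of_three hcubic hab.symm hbc hbd
        (by assumption) (by assumption) (by assumption) hxy
      tauto
    · have := eq_of_adj_of_three hcubic hac.symm hbc.symm hcd
        (by assumption) (by assumption) (by assumption) hxy
      tauto
    · have := eq_of_adj_of_three hcubic had.symm hbd.symm hcd.symm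
        (by assumption) (by assumption) (by assumption) hxy
      tauto
  have hinj : Function.Injective ![a, b, c, d] := by
    intro i j
    fin_cases i <;> fin_cases j <;> simp <;> grind
  have hsurj : Function.Surjective ![a, b, c, d] := by
    intro v
    have := hmem v
    simp only [Fin.exists_fin_succ]
    simpa [eq_comm] using this
  refine hK4 ⟨SimpleGraph.Iso.symm ⟨Equiv.ofBijective _ ⟨hinj, hsurj⟩, ?_⟩⟩
  intro i j
  change G.Adj (![a, b, c, d] i) (![a, b, c, d] j) ↔ _
  fin_cases i <;> fin_cases j <;> simp [hab, hac, had, hbc, hbd, hcd, hab.symm, hac.symm, hbc.symm,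
        had.symm, hbd.symm, hcd.symm]

/-- Otherwise `v` and its three neighbours form an induced claw. This is the only use of
claw-freeness. -/
theorem exists_triangle (hclaw : IsClawFree G) (hcubic : G.IsRegularOfDegree 3) (v : V) :
    ∃ x y, G.Adj v x ∧ G.Adj v y ∧ G.Adj x y := by
  obtain ⟨x, y, z, hxy, hxz, hyz, h⟩ := Finset.card_eq_three.1
    ((G.card_neighborFinset_eq_degree v).trans (hcubic.degree_eq v))
  have hx : G.Adj v x := by rw [← SimpleGraph.mem_neighborFinset, h]; simp
  have hy : G.Adj v y := by rw [← SimpleGraph.mem_neighborFinset, h]; simp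
  have hz : G.Adj v z := by rw [← SimpleGraph.mem_neighborFinset, h]; simp
  by_contra! hno
  have h1 := hno x y hx hy
  have h2 := hno x z hx hz
  have h3 := hno y z hy hz
  have h1' := hno y x hy hx
  have h2' := hno z x hz hx
  have h3' := hno z y hz hy
  have := hx.ne; have := hy.ne; have := hz.ne
  refine hclaw ⟨⟨⟨Sum.elim (fun _ => v) ![x, y, z], ?_⟩, ?_⟩⟩
  · rintro (i | i) (j | j)
    · simp [Subsingleton.elim i j]
    · fin_cases j <;> simp <;> grind
    · fin_cases i <;> simp <;> grind
    · fin_cases i <;> fin_cases j <;> simp <;> grind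
  · intro i j
    change G.Adj (Sum.elim (fun _ => v) ![x, y, z] i) (Sum.elim (fun _ => v) ![x, y, z] j) ↔ _
    rcases i with i | i <;> rcases j with j | j
    · simp
    · fin_cases j <;> simp [hx, hy, hz]
    · fin_cases i <;> simp [hx.symm, hy.symm, hz.symm]
    · fin_cases i <;> fin_cases j <;> simp [h1, h2, h3, h1', h2', h3']

/-- A triangle that meets an induced diamond is contained in it. -/
theorem IsTri.subset_of_meet (hcubic : G.IsRegularOfDegree 3) {T D : Finset V} (hT : IsTri G T)
    (hD : IsDia G D) {v : V} (hvT : v ∈ T) (hvD : v ∈ D) : T ⊆ D := by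
  obtain ⟨a, b, c, d, hac, had, hbc, hbd, hcd, hab, hne, rfl⟩ := hD
  obtain ⟨x, y, z, hxy, hxz, hyz, rfl⟩ := hT
  have hc : ∀ w, G.Adj c w → w = a ∨ w = b ∨ w = d := fun w hw =>
    eq_of_adj_of_three hcubic hac.symm hbc.symm hcd hne had.ne hbd.ne hw
  have hd : ∀ w, G.Adj d w → w = a ∨ w = b ∨ w = c := fun w hw =>
    eq_of_adj_of_three hcubic had.symm hbd.symm hcd.symm hne hac.ne hbc.ne hw
  have key : ∀ v x y, G.Adj v x → G.Adj v y → G.Adj x y → v = a ∨ v = b ∨ v = c ∨ v = d →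
      (x = a ∨ x = b ∨ x = c ∨ x = d) ∧ (y = a ∨ y = b ∨ y = c ∨ y = d) := by
    clear * - hc hd hac had hbc hbd hcd hcubic
    intro v x y hvx hvy hxy hv
    -- A vertex adjacent to `c` and `d` has only one further neighbour, so a triangle through it
    -- uses `c` or `d`, whose neighbours all lie in the diamond.
    have h2 : ∀ v, G.Adj v c → G.Adj v d → G.Adj v x → G.Adj v y →
        x = c ∨ x = d ∨ y = c ∨ y = d := by
      intro v h1 h2 h3 h4
      by_contra! hh
      have := eq_of_adj_of_three hcubic h1 h2 h3 hcd.ne hh.1.symm hh.2.1.symm h4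
      have := hxy.ne
      grind
    have hcs := fun w (hw : G.Adj w c) => hc w hw.symm
    have hds := fun w (hw : G.Adj w d) => hd w hw.symm
    rcases hv with rfl | rfl | rfl | rfl
    · rcases h2 v hac had hvx hvy with rfl | rfl | rfl | rfl
      · have := hc _ hxy; grind
      · have := hd _ hxy; grind
      · have := hc _ hxy.symm; grind
      · have := hd _ hxy.symm; grind
    · rcases h2 v hbc hbd hvx hvy with rfl | rfl | rfl | rfl
      · have := hc _ hxy; grind
      · have := hd _ hxy; grind
      · have := hc _ hxy.symm; grind
      · have := hd _ hxy.symm; grind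
    · have := hc _ hvx; have := hc _ hvy; grind
    · have := hd _ hvx; have := hd _ hvy; grind
  simp only [Finset.mem_insert, Finset.mem_singleton] at hvT hvD
  intro w hw
  simp only [Finset.mem_insert, Finset.mem_singleton] at hw ⊢
  rcases hvT with rfl | rfl | rfl
  · have := key _ _ _ hxy hxz hyz hvD; grind
  · have := key _ _ _ hxy.symm hyz hxz hvD; grind
  · have := key _ _ _ hxz.symm hyz.symm hxy hvD; grind

theorem IsDia.eq_of_meet (hcubic : G.IsRegularOfDegree 3) {D D' : Finset V} (hD : IsDia G D)
    (hD' : IsDia G D') {v : V} (hv : v ∈ D) (hv' : v ∈ D') : D = D' := by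
  refine Finset.eq_of_subset_of_card_le ?_ (by rw [hD.card_eq, hD'.card_eq])
  obtain ⟨a, b, c, d, hac, had, hbc, hbd, hcd, hab, hne, rfl⟩ := hD
  have h1 : IsTri G {a, c, d} := ⟨a, c, d, hac, had, hcd, rfl⟩
  have h2 : IsTri G {b, c, d} := ⟨b, c, d, hbc, hbd, hcd, rfl⟩
  have hc : c ∈ D' := by
    simp only [Finset.mem_insert, Finset.mem_singleton] at hv
    rcases hv with rfl | rfl | rfl | rfl
    · exact h1.subset_of_meet hcubic hD' (by simp) hv' (by simp)
    · exact h2.subset_of_meet hcubic hD' (by simp) hv' (by simp)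
    · exact hv'
    · exact h1.subset_of_meet hcubic hD' (by simp) hv' (by simp)
  have h1' := h1.subset_of_meet hcubic hD' (v := c) (by simp) hc
  have h2' := h2.subset_of_meet hcubic hD' (v := c) (by simp) hc
  intro w hw
  simp only [Finset.subset_iff, Finset.mem_insert, Finset.mem_singleton] at h1' h2' hw
  grind

/-- The units of a cubic claw-free graph: the induced diamonds, and the triangles that no induced
diamond contains. -/
def IsUnitSet (G : SimpleGraph V) (U : Finset V) : Prop :=
  IsDia G U ∨ (IsTri G U ∧ ∀ D, IsDia G D → ¬ U ⊆ D)

/-- Two pairs of neighbours of a vertex of degree 3 must intersect, so distinct triangles through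
`v` share an edge; their union is a diamond, since a 4-clique is excluded. -/
theorem IsTri.eq_or_subset_dia (hconn : G.Connected) (hcubic : G.IsRegularOfDegree 3)
    (hK4 : ¬ Nonempty (G ≃g (⊤ : SimpleGraph (Fin 4)))) {T T' : Finset V} (hT : IsTri G T)
    (hT' : IsTri G T') {v : V} (hv : v ∈ T) (hv' : v ∈ T') :
    T = T' ∨ ∃ D, IsDia G D ∧ T ⊆ D := by
  have key : ∀ {U : Finset V}, IsTri G U → v ∈ U →
      ∃ x y, G.Adj v x ∧ G.Adj v y ∧ G.Adj x y ∧ U = {v, x, y} := by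
    rintro _ ⟨x, y, z, hxy, hxz, hyz, rfl⟩ hv
    simp only [Finset.mem_insert, Finset.mem_singleton] at hv
    rcases hv with rfl | rfl | rfl
    · exact ⟨y, z, hxy, hxz, hyz, rfl⟩
    · exact ⟨x, z, hxy.symm, hyz, hxz, by grind⟩
    · exact ⟨x, y, hxz.symm, hyz.symm, hxy, by grind⟩
  obtain ⟨x, y, hvx, hvy, hxy, rfl⟩ := key hT hv
  obtain ⟨z, w, hvz, hvw, hzw, rfl⟩ := key hT' hv'
  have main : ∀ x y z, G.Adj v x → G.Adj v y → G.Adj x y → G.Adj v z → G.Adj x z → y ≠ z →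
      ∃ D, IsDia G D ∧ ({v, x, y} : Finset V) ⊆ D := by
    intro x y z hvx hvy hxy hvz hxz hne
    by_cases hyz : G.Adj y z
    · exact (not_four_clique hconn hcubic hK4 hvx hvy hvz hxy hxz hyz).elim
    · exact ⟨{y, z, v, x}, ⟨y, z, v, x, hvy.symm, hxy.symm, hvz.symm, hxz.symm, hvx, hyz, hne, rfl⟩,
        by grind⟩
  by_cases hzx : z = x
  · subst hzx
    by_cases hwy : w = y
    · subst hwy; exact Or.inl rfl
    · exact Or.inr (main z y w hvx hvy hxy hvw hzw (Ne.symm hwy))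
  by_cases hzy : z = y
  · subst hzy
    by_cases hwx : w = x
    · subst hwx; left; grind
    · right
      have := main z x w hvy hvx hxy.symm hvw hzw (Ne.symm hwx)
      rwa [Finset.pair_comm] at this
  · have := eq_of_adj_of_three hcubic hvx hvy hvz hxy.ne (Ne.symm hzx) (Ne.symm hzy) hvw
    rcases this with rfl | rfl | rfl
    · exact Or.inr (main w y z hvx hvy hxy hvz hzw.symm (Ne.symm hzy))
    · right
      have := main w x z hvy hvx hxy.symm hvz hzw.symm (Ne.symm hzx)
      rwa [Finset.pair_comm] at this
    · exact (hzw.ne rfl).elim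

theorem IsUnitSet.eq_of_meet (hconn : G.Connected) (hcubic : G.IsRegularOfDegree 3)
    (hK4 : ¬ Nonempty (G ≃g (⊤ : SimpleGraph (Fin 4)))) {U W : Finset V} (hU : IsUnitSet G U)
    (hW : IsUnitSet G W) {v : V} (hv : v ∈ U) (hv' : v ∈ W) : U = W := by
  rcases hU with hU | ⟨hU, hU'⟩ <;> rcases hW with hW | ⟨hW, hW'⟩
  · exact hU.eq_of_meet hcubic hW hv hv'
  · exact (hW' _ hU (hW.subset_of_meet hcubic hU hv' hv)).elim
  · exact (hU' _ hW (hU.subset_of_meet hcubic hW hv hv')).elim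
  · rcases hU.eq_or_subset_dia hconn hcubic hK4 hW hv hv' with h | ⟨D, hD, h⟩
    · exact h
    · exact (hU' D hD h).elim

/-- If a triangle part lay in a diamond, the part of the fourth vertex would meet that diamond in
one vertex only, whereas any triangle or diamond meeting it does so in at least three. -/
theorem isUnitSet_of_mem_parts (hcubic : G.IsRegularOfDegree 3)
    {P : Finpartition (Finset.univ : Finset V)} (hP : ∀ U ∈ P.parts, IsTri G U ∨ IsDia G U)
    {U : Finset V} (hU : U ∈ P.parts) : IsUnitSet G U := by
  rcases hP U hU with hT | hD
  swap
  · exact Or.inl hD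
  refine Or.inr ⟨hT, fun D hD hsub => ?_⟩
  have hlt : U.card < D.card := by rw [hT.card_eq, hD.card_eq]; omega
  obtain ⟨z, hzD, hzU⟩ := Finset.exists_mem_notMem_of_card_lt_card hlt
  have hz := P.mem_part (Finset.mem_univ z)
  have hW : P.part z ∈ P.parts := P.part_mem.2 (Finset.mem_univ z)
  have hne : U ≠ P.part z := fun h => hzU (h ▸ hz)
  have hdisj : Disjoint U (P.part z) := P.disjoint hU hW hne
  have hcard : (P.part z ∩ D).card ≤ 1 := by
    have : (P.part z ∩ D) ⊆ D \ U := by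
      intro w hw
      rw [Finset.mem_inter] at hw
      exact Finset.mem_sdiff.2 ⟨hw.2, fun h => Finset.disjoint_left.1 hdisj h hw.1⟩
    have h2 := Finset.card_le_card this
    rw [Finset.card_sdiff_of_subset hsub, hT.card_eq, hD.card_eq] at h2
    exact h2
  have h3 : 3 ≤ (P.part z ∩ D).card := by
    rcases hP _ hW with h | h
    · rw [Finset.inter_eq_left.2 (h.subset_of_meet hcubic hD hz hzD), h.card_eq]
    · rw [h.eq_of_meet hcubic hD hz hzD, Finset.inter_self, hD.card_eq]
      omega
  omega

theorem existsUnique_partition (hconn : G.Connected) (hclaw : IsClawFree G)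
    (hcubic : G.IsRegularOfDegree 3) (hK4 : ¬ Nonempty (G ≃g (⊤ : SimpleGraph (Fin 4)))) :
    ∃! P : Finpartition (Finset.univ : Finset V), IsTriangleDiamondPartition G P := by
  classical
  have hcover : ∀ v, ∃ U, IsUnitSet G U ∧ v ∈ U := by
    intro v
    obtain ⟨x, y, hx, hy, hxy⟩ := exists_triangle hclaw hcubic v
    have hT : IsTri G {v, x, y} := ⟨v, x, y, hx, hy, hxy, rfl⟩
    by_cases h : ∃ D, IsDia G D ∧ {v, x, y} ⊆ D
    · obtain ⟨D, hD, hs⟩ := h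
      exact ⟨D, Or.inl hD, hs (by simp)⟩
    · push Not at h
      exact ⟨_, Or.inr ⟨hT, h⟩, by simp⟩
  refine ⟨Finpartition.ofExistsUnique (Finset.univ.filter (IsUnitSet G)) (fun _ _ => Finset.subset_univ _)
    ?_ ?_, ?_, ?_⟩
  · intro v _
    obtain ⟨U, hU, hv⟩ := hcover v
    refine ⟨U, ⟨by simpa using hU, hv⟩, ?_⟩
    rintro W ⟨hW, hvW⟩
    exact IsUnitSet.eq_of_meet hconn hcubic hK4 (by simpa using hW) hU hvW hv
  · rw [Finset.mem_filter]
    rintro ⟨-, h | h⟩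
    · simpa using h.card_eq
    · simpa using h.1.card_eq
  · refine (isTriangleDiamondPartition_iff _).2 fun U hU => ?_
    have : IsUnitSet G U := by simpa using (Finset.mem_filter.1 hU).2
    rcases this with h | h
    · exact Or.inr h
    · exact Or.inl h.1
  · intro Q hQ
    rw [isTriangleDiamondPartition_iff] at hQ
    ext U
    change U ∈ Q.parts ↔ U ∈ Finset.univ.filter (IsUnitSet G)
    rw [Finset.mem_filter]
    constructor
    · exact fun h => ⟨Finset.mem_univ _, isUnitSet_of_mem_parts hcubic hQ h⟩
    · rintro ⟨-, h⟩
      have : U.Nonempty := by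
        rw [← Finset.card_pos]
        rcases h with h | h
        · rw [h.card_eq]; omega
        · rw [h.1.card_eq]; omega
      obtain ⟨v, hv⟩ := this
      have hQv : Q.part v ∈ Q.parts := Q.part_mem.2 (Finset.mem_univ v)
      rw [h.eq_of_meet hconn hcubic hK4 (isUnitSet_of_mem_parts hcubic hQ hQv) hv
        (Q.mem_part (Finset.mem_univ v))]
      exact hQv

end Cubic

/-! ### Spread of infection inside a unit. -/

theorem Infected.of_two {S : Finset V} {v a b : V} (ha : G.Adj v a) (hb : G.Adj v b) (hab : a ≠ b)
    (hia : Infected G 2 S a) (hib : Infected G 2 S b) : Infected G 2 S v := by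
  classical
  refine Infected.step v {a, b} (Finset.card_pair hab).ge ?_ ?_ <;>
  · intro u hu
    simp only [Finset.mem_insert, Finset.mem_singleton] at hu
    rcases hu with rfl | rfl <;> assumption

/-- `t` and `e` are adjacent vertices of `U` whose infection spreads to all of `U`. -/
def Ignites (G : SimpleGraph V) (U : Finset V) (t e : V) : Prop :=
  t ∈ U ∧ G.Adj t e ∧
    ∀ S : Finset V, Infected G 2 S t → Infected G 2 S e → ∀ x ∈ U, Infected G 2 S x

theorem IsTri.ignites [DecidableEq V] {U : Finset V} (hU : IsTri G U) {t e : V} (ht : t ∈ U)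
    (he : e ∈ U) (hne : t ≠ e) : Ignites G U t e := by
  obtain ⟨a, b, c, hab, hac, hbc, rfl⟩ := hU
  simp only [Finset.mem_insert, Finset.mem_singleton] at ht he
  have key : ∀ x, x = a ∨ x = b ∨ x = c → x ≠ t → G.Adj x t := by
    rintro x hx hxt
    rcases hx with rfl | rfl | rfl <;> rcases ht with rfl | rfl | rfl <;>
      first | exact (hxt rfl).elim | assumption | (apply SimpleGraph.Adj.symm; assumption)
  have key' : ∀ x, x = a ∨ x = b ∨ x = c → x ≠ e → G.Adj x e := by
    rintro x hx hxt
    rcases hx with rfl | rfl | rfl <;> rcases he with rfl | rfl | rfl <;>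
      first | exact (hxt rfl).elim | assumption | (apply SimpleGraph.Adj.symm; assumption)
  refine ⟨by simpa using ht, key' t ht hne, fun S h1 h2 x hx => ?_⟩
  simp only [Finset.mem_insert, Finset.mem_singleton] at hx
  by_cases hxt : x = t
  · rwa [hxt]
  by_cases hxe : x = e
  · rwa [hxe]
  · exact .of_two (key x hx hxt) (key' x hx hxe) hne h1 h2

/-- In a diamond `t` is chosen so that `t` and `e` lie in a common triangle; its third vertex
follows, and the two vertices of degree 3 infect the rest. -/
theorem exists_ignites [DecidableEq V] {U : Finset V} (hU : IsTri G U ∨ IsDia G U) {e : V}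
    (he : e ∈ U) : ∃ t, Ignites G U t e := by
  rcases hU with hU | hU
  · have : ∃ t ∈ U, t ≠ e := by
      apply Finset.exists_mem_ne
      rw [hU.card_eq]
      omega
    obtain ⟨t, ht, hne⟩ := this
    exact ⟨t, hU.ignites ht he hne⟩
  · obtain ⟨a, b, c, d, hac, had, hbc, hbd, hcd, hab, hne, rfl⟩ := hU
    have main : ∀ S : Finset V, Infected G 2 S c → Infected G 2 S d →
        ∀ x ∈ ({a, b, c, d} : Finset V), Infected G 2 S x := by
      intro S hc hd x hx
      simp only [Finset.mem_insert, Finset.mem_singleton] at hx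
      rcases hx with rfl | rfl | rfl | rfl
      · exact .of_two hac had hcd.ne hc hd
      · exact .of_two hbc hbd hcd.ne hc hd
      · exact hc
      · exact hd
    simp only [Finset.mem_insert, Finset.mem_singleton] at he
    rcases he with rfl | rfl | rfl | rfl
    · exact ⟨c, by simp, hac.symm, fun S h1 h2 => main S h1 (.of_two had.symm hcd.symm hac.ne h2 h1)⟩
    · exact ⟨c, by simp, hbc.symm, fun S h1 h2 => main S h1 (.of_two hbd.symm hcd.symm hbc.ne h2 h1)⟩
    · exact ⟨d, by simp, hcd.symm, fun S h1 h2 => main S h2 h1⟩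
    · exact ⟨c, by simp, hcd, fun S h1 h2 => main S h1 h2⟩

theorem exists_two_neighbors [DecidableEq V] {U : Finset V} (hU : IsTri G U ∨ IsDia G U) {v : V}
    (hv : v ∈ U) : ∃ x ∈ U, ∃ y ∈ U, x ≠ y ∧ G.Adj v x ∧ G.Adj v y := by
  rcases hU with ⟨a, b, c, hab, hac, hbc, rfl⟩ | ⟨a, b, c, d, hac, had, hbc, hbd, hcd, hab, hne, rfl⟩ <;>
    simp only [Finset.mem_insert, Finset.mem_singleton] at hv
  · rcases hv with rfl | rfl | rfl
    · exact ⟨b, by simp, c, by simp, hbc.ne, hab, hac⟩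
    · exact ⟨a, by simp, c, by simp, hac.ne, hab.symm, hbc⟩
    · exact ⟨a, by simp, b, by simp, hab.ne, hac.symm, hbc.symm⟩
  · rcases hv with rfl | rfl | rfl | rfl
    · exact ⟨c, by simp, d, by simp, hcd.ne, hac, had⟩
    · exact ⟨c, by simp, d, by simp, hcd.ne, hbc, hbd⟩
    · exact ⟨a, by simp, b, by simp, hne, hac.symm, hbc.symm⟩
    · exact ⟨a, by simp, b, by simp, hne, had.symm, hbd.symm⟩

/-- Two of the three neighbours of `v` are already inside its unit. -/
theorem eq_of_adj_of_notMem [Fintype V] [DecidableEq V] [DecidableRel G.Adj]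
    (hcubic : G.IsRegularOfDegree 3) {U : Finset V} (hU : IsTri G U ∨ IsDia G U) {v p q : V}
    (hv : v ∈ U) (hp : p ∉ U) (hq : q ∉ U) (hvp : G.Adj v p) (hvq : G.Adj v q) : p = q := by
  obtain ⟨x, hx, y, hy, hxy, hvx, hvy⟩ := exists_two_neighbors hU hv
  have hne : ∀ {z}, z ∈ U → z ≠ q := fun hz h => hq (h ▸ hz)
  rcases eq_of_adj_of_three hcubic hvx hvy hvq hxy (hne hx) (hne hy) hvp with rfl | rfl | rfl
  · exact (hp hx).elim
  · exact (hp hy).elim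
  · rfl

theorem exists_isTri_subset [DecidableEq V] {U : Finset V} (hU : IsTri G U ∨ IsDia G U) : ∃ T ⊆ U, IsTri G T := by
  rcases hU with h | ⟨a, b, c, d, hac, had, hbc, hbd, hcd, hab, hne, rfl⟩
  · exact ⟨U, subset_rfl, h⟩
  · exact ⟨{a, c, d}, by grind, a, c, d, hac, had, hcd, rfl⟩

/-! ### Upper bounds: seeds along a ranking of the units. -/

section Spread

variable [Fintype V] [DecidableEq V]

/-- If `r` reaches every vertex, the parts of a partition can be ranked so that every part not
containing `r` is entered through an edge from a part of smaller rank. -/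
theorem exists_rank (G' : SimpleGraph V) (P : Finpartition (Finset.univ : Finset V)) (r : V)
    (hr : ∀ v, G'.Reachable r v) :
    ∃ m : Finset V → ℕ, ∀ U ∈ P.parts, r ∉ U →
      ∃ e ∈ U, ∃ p, p ∉ U ∧ G'.Adj p e ∧ m (P.part p) < m U := by
  -- The rank of `U` is its least distance from `r`, `e` attains it, and `p` precedes `e` on a
  -- shortest walk, so `p` is too close to `r` to lie in `U`.
  refine ⟨fun U => sInf (G'.dist r '' U), fun U hU hrU => ?_⟩
  have hne : (G'.dist r '' (U : Set V)).Nonempty :=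
    (Finset.coe_nonempty.2 (P.nonempty_of_mem_parts hU)).image _
  obtain ⟨e, he, hme⟩ := Nat.sInf_mem hne
  have her : e ≠ r := fun h => hrU (h ▸ he)
  obtain ⟨w, hw⟩ := (hr e).exists_walk_length_eq_dist
  have hnil : ¬ w.Nil := fun h => her h.eq.symm
  have hlt : G'.dist r w.penultimate < G'.dist r e := by
    refine lt_of_le_of_lt (SimpleGraph.dist_le w.dropLast) ?_
    have := w.length_dropLast_add_one hnil
    omega
  refine ⟨e, he, w.penultimate, fun hp => ?_, w.adj_penultimate hnil, ?_⟩
  · have := Nat.sInf_le (Set.mem_image_of_mem (G'.dist r) (Finset.mem_coe.2 hp))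
    omega
  · have := Nat.sInf_le (Set.mem_image_of_mem (G'.dist r)
      (Finset.mem_coe.2 (P.mem_part (Finset.mem_univ w.penultimate))))
    exact (this.trans_lt hlt).trans_eq hme

/-- Infection spreads along a ranking of the units if every unit but the first has a seed that
ignites it from its entry vertex. -/
theorem isPercolatingSet_of_seeds (P : Finpartition (Finset.univ : Finset V)) (r : V) (S : Finset V)
    (m : Finset V → ℕ) (hr : ∀ v ∈ P.part r, Infected G 2 S v)
    (hm : ∀ U ∈ P.parts, r ∉ U → ∃ e ∈ U, ∃ p, p ∉ U ∧ G.Adj p e ∧ m (P.part p) < m U ∧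
      ∃ t ∈ S, Ignites G U t e) : IsPercolatingSet G 2 S := by
  have main : ∀ n, ∀ U ∈ P.parts, m U = n → ∀ v ∈ U, Infected G 2 S v := by
    intro n
    induction n using Nat.strong_induction_on with
    | _ n ih =>
      rintro U hU rfl
      by_cases hrU : r ∈ U
      · rwa [← P.part_eq_of_mem hU hrU]
      obtain ⟨e, he, p, hp, hpe, hlt, t, htS, htU, hte, hign⟩ := hm U hU hrU
      have hpi := ih _ hlt _ (P.part_mem.2 (Finset.mem_univ p)) rfl p (P.mem_part (Finset.mem_univ p))
      have hti : Infected G 2 S t := .init t htS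
      -- The entry vertex `e` is infected by `p` and `t`, which differ since only `t` lies in `U`.
      exact hign S hti (.of_two hpe.symm hte.symm (fun h => hp (h ▸ htU)) hpi hti)
  exact fun v => main _ _ (P.part_mem.2 (Finset.mem_univ v)) rfl v (P.mem_part (Finset.mem_univ v))

theorem exists_percolatingSet_card_le_succ (hconn : G.Connected)
    {P : Finpartition (Finset.univ : Finset V)} (hP : ∀ U ∈ P.parts, IsTri G U ∨ IsDia G U) :
    ∃ S, IsPercolatingSet G 2 S ∧ S.card ≤ P.parts.card + 1 := by
  obtain ⟨r⟩ := hconn.nonempty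
  obtain ⟨m, hm⟩ := exists_rank G P r (fun v => hconn.preconnected r v)
  have hseed : ∀ U, ∃ t, U ∈ P.parts → (r ∈ U → Ignites G U t r) ∧
      (r ∉ U → ∃ e ∈ U, ∃ p, p ∉ U ∧ G.Adj p e ∧ m (P.part p) < m U ∧ Ignites G U t e) := by
    intro U
    by_cases hU : U ∈ P.parts
    · by_cases hrU : r ∈ U
      · obtain ⟨t, ht⟩ := exists_ignites (hP U hU) hrU
        exact ⟨t, fun _ => ⟨fun _ => ht, fun h => (h hrU).elim⟩⟩
      · obtain ⟨e, he, p, hp, hpe, hlt⟩ := hm U hU hrU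
        obtain ⟨t, ht⟩ := exists_ignites (hP U hU) he
        exact ⟨t, fun _ => ⟨fun h => (hrU h).elim, fun _ => ⟨e, he, p, hp, hpe, hlt, ht⟩⟩⟩
    -- Arbitrary value off the parts, so that `choose` gives a total function.
    · exact ⟨r, fun h => (hU h).elim⟩
  choose s hs using hseed
  refine ⟨insert r (P.parts.image s), ?_, (Finset.card_insert_le _ _).trans
    (Nat.succ_le_succ Finset.card_image_le)⟩
  have hsmem : ∀ U ∈ P.parts, s U ∈ insert r (P.parts.image s) := fun U hU =>
    Finset.mem_insert_of_mem (Finset.mem_image_of_mem s hU)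
  refine isPercolatingSet_of_seeds P r _ m ?_ ?_
  · have hpart := P.part_mem.2 (Finset.mem_univ r)
    exact ((hs _ hpart).1 (P.mem_part (Finset.mem_univ r))).2.2 _
      (.init _ (hsmem _ hpart)) (.init _ (Finset.mem_insert_self _ _))
  · intro U hU hrU
    obtain ⟨e, he, p, hp, hpe, hlt, ht⟩ := (hs U hU).2 hrU
    exact ⟨e, he, p, hp, hpe, hlt, s U, hsmem U hU, ht⟩

/-- The edge `xy` is the only edge between `C ∋ y` and its complement, which contains `x`. -/
def IsCutBy (G : SimpleGraph V) (C : Finset V) (x y : V) : Prop :=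
  x ∉ C ∧ y ∈ C ∧ ∀ p q, p ∉ C → q ∈ C → G.Adj p q → p = x ∧ q = y

/-- If `x` were unreachable from `y` after the deletion, the component of `y` would be a side cut
off by `xy`. -/
theorem reachable_deleteEdge (hconn : G.Connected) {x y : V}
    (hcut : ∀ C, ¬ IsCutBy G C x y) (v : V) : (G.deleteEdges {s(x, y)}).Reachable y v := by
  classical
  set G' := G.deleteEdges {s(x, y)} with hG'
  have hstep : ∀ p q, G'.Reachable y p → G.Adj p q → G'.Reachable y q ∨ s(p, q) = s(x, y) := by
    intro p q hp hpq
    by_cases h : s(p, q) = s(x, y)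
    · exact Or.inr h
    · refine Or.inl (hp.trans (SimpleGraph.Adj.reachable ?_))
      rw [hG', SimpleGraph.deleteEdges_adj]
      exact ⟨hpq, h⟩
  have hx : G'.Reachable y x := by
    by_contra hx
    refine hcut (Finset.univ.filter (G'.Reachable y)) ⟨by simpa using hx, by simp, ?_⟩
    intro p q hp hq hpq
    simp only [Finset.mem_filter, Finset.mem_univ, true_and] at hp hq
    rcases hstep q p hq hpq.symm with h | h
    · exact (hp h).elim
    · rw [Sym2.eq_iff] at h
      rcases h with ⟨rfl, rfl⟩ | ⟨rfl, rfl⟩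
      · exact (hx hq).elim
      · exact ⟨rfl, rfl⟩
  refine mem_of_closed hconn (C := {v | G'.Reachable y v}) (r := y) (by simp) ?_ v
  intro p q hp hpq
  rcases hstep p q hp hpq with h | h
  · exact h
  · rw [Sym2.eq_iff] at h
    rcases h with ⟨rfl, rfl⟩ | ⟨rfl, rfl⟩
    · exact .refl _
    · exact hx

/-- If a unit that is a triangle has a vertex `x` whose edge `xy` to another unit is not a bridge,
then one infected vertex per unit suffices. -/
theorem exists_percolatingSet_card_le [DecidableRel G.Adj] (hconn : G.Connected)
    (hcubic : G.IsRegularOfDegree 3) {P : Finpartition (Finset.univ : Finset V)}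
    (hP : ∀ U ∈ P.parts, IsTri G U ∨ IsDia G U) {x y : V} (hT : IsTri G (P.part x))
    (hy : y ∉ P.part x) (hxy : G.Adj x y) (hcut : ∀ C, ¬ IsCutBy G C x y) :
    ∃ S, IsPercolatingSet G 2 S ∧ S.card ≤ P.parts.card := by
  obtain ⟨m, hm⟩ := exists_rank _ P y (reachable_deleteEdge hconn hcut)
  have hxm := P.mem_part (Finset.mem_univ x)
  have hseed : ∀ U, ∃ t, U ∈ P.parts → (x ∈ U → t = x) ∧ (y ∈ U → Ignites G U t y) ∧
      (y ∉ U → ∃ e ∈ U, ∃ p, p ∉ U ∧ G.Adj p e ∧ m (P.part p) < m U ∧ Ignites G U t e) := by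
    intro U
    by_cases hU : U ∈ P.parts
    swap
    · exact ⟨x, fun h => (hU h).elim⟩
    by_cases hyU : y ∈ U
    · obtain ⟨t, ht⟩ := exists_ignites (hP U hU) hyU
      refine ⟨t, fun _ => ⟨fun h => ?_, fun _ => ht, fun h => (h hyU).elim⟩⟩
      rw [P.part_eq_of_mem hU h] at hy
      exact (hy hyU).elim
    obtain ⟨e, he, p, hp, hpe, hlt⟩ := hm U hU hyU
    rw [SimpleGraph.deleteEdges_adj] at hpe
    by_cases hxU : x ∈ U
    · have hUx := P.part_eq_of_mem hU hxU
      -- The only edge leaving the triangle at `x` is `xy`, which has been deleted.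
      have hne : x ≠ e := by
        rintro rfl
        have := eq_of_adj_of_notMem hcubic (hP U hU) hxU hp hyU hpe.1.symm hxy
        exact hpe.2 (by rw [this]; exact Sym2.eq_swap)
      exact ⟨x, fun _ => ⟨fun _ => rfl, fun h => (hyU h).elim, fun _ =>
        ⟨e, he, p, hp, hpe.1, hlt, (hUx ▸ hT).ignites hxU he hne⟩⟩⟩
    · obtain ⟨t, ht⟩ := exists_ignites (hP U hU) he
      exact ⟨t, fun _ => ⟨fun h => (hxU h).elim, fun h => (hyU h).elim,
        fun _ => ⟨e, he, p, hp, hpe.1, hlt, ht⟩⟩⟩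
  choose s hs using hseed
  have hsmem : ∀ U ∈ P.parts, s U ∈ P.parts.image s := fun U hU => Finset.mem_image_of_mem s hU
  refine ⟨P.parts.image s, isPercolatingSet_of_seeds P y _ m ?_ ?_, Finset.card_image_le⟩
  · have hpart := P.part_mem.2 (Finset.mem_univ y)
    have hpartx := P.part_mem.2 (Finset.mem_univ x)
    obtain ⟨hsU, hadj, hign⟩ := (hs _ hpart).2.1 (P.mem_part (Finset.mem_univ y))
    have hx : x ∈ P.parts.image s := by
      have := (hs _ hpartx).1 hxm
      rw [← this]
      exact hsmem _ hpartx
    -- The root `y` is not a seed by choice: it is infected by `x` and by the seed of its own unit.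
    refine hign _ (.init _ (hsmem _ hpart)) (.of_two hxy.symm hadj.symm ?_ (.init _ hx)
      (.init _ (hsmem _ hpart)))
    intro h
    rw [← h] at hsU
    rw [P.part_eq_of_mem hpart hsU] at hy
    exact hy (P.mem_part (Finset.mem_univ y))
  · intro U hU hyU
    obtain ⟨e, he, p, hp, hpe, hlt, ht⟩ := (hs U hU).2.2 hyU
    exact ⟨e, he, p, hp, hpe, hlt, s U, hsmem U hU, ht⟩

/-! ### A non-bridge edge leaving a triangle. -/

/-- Every vertex of a triangle unit has a neighbor in another unit. -/
theorem IsTri.exists_adj_notMem [DecidableRel G.Adj] (hcubic : G.IsRegularOfDegree 3)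
    {U : Finset V} (hU : IsTri G U) {v : V} (hv : v ∈ U) : ∃ w, w ∉ U ∧ G.Adj v w := by
  by_contra! h
  have hsub : G.neighborFinset v ⊆ U.erase v := by
    intro w hw
    rw [SimpleGraph.mem_neighborFinset] at hw
    exact Finset.mem_erase.2 ⟨hw.ne.symm, by_contra fun hwU => h w hwU hw⟩
  have := Finset.card_le_card hsub
  rw [Finset.card_erase_of_mem hv, hU.card_eq, SimpleGraph.card_neighborFinset_eq_degree,
    hcubic.degree_eq] at this
  omega

/-- A diamond unit, seen from a vertex `y` with a neighbor outside. -/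
theorem IsDia.exists_eq_of_adj_notMem [DecidableRel G.Adj] (hcubic : G.IsRegularOfDegree 3)
    {U : Finset V} (hU : IsDia G U) {x y : V} (hy : y ∈ U) (hx : x ∉ U) (hyx : G.Adj y x) :
    ∃ b c d, G.Adj y c ∧ G.Adj y d ∧ G.Adj b c ∧ G.Adj b d ∧ G.Adj c d ∧ ¬ G.Adj y b ∧ y ≠ b ∧
      U = {y, b, c, d} := by
  obtain ⟨a, b, c, d, hac, had, hbc, hbd, hcd, hab, hne, rfl⟩ := hU
  simp only [Finset.mem_insert, Finset.mem_singleton] at hy hx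
  rcases hy with rfl | rfl | rfl | rfl
  · exact ⟨b, c, d, hac, had, hbc, hbd, hcd, hab, hne, rfl⟩
  · exact ⟨a, c, d, hbc, hbd, hac, had, hcd, fun h => hab h.symm, hne.symm, Finset.insert_comm _ _ _⟩
  · have := eq_of_adj_of_three hcubic hac.symm hbc.symm hcd hne had.ne hbd.ne hyx
    exact (hx (by clear * - this; tauto)).elim
  · have := eq_of_adj_of_three hcubic had.symm hbd.symm hcd.symm hne hac.ne hbc.ne hyx
    exact (hx (by clear * - this; tauto)).elim

/-- Take a smallest side `C` of a bridge `xy` between units. If the unit of `y` is a diamond, the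
edge at its other end is a bridge with a smaller side. So it is a triangle, and a bridge at another
of its vertices would again give a smaller side. -/
theorem exists_not_isCutBy [DecidableRel G.Adj] (hcubic : G.IsRegularOfDegree 3)
    {P : Finpartition (Finset.univ : Finset V)} (hP : ∀ U ∈ P.parts, IsTri G U ∨ IsDia G U)
    {T : Finset V} (hTP : T ∈ P.parts) (hT : IsTri G T) :
    ∃ x y, IsTri G (P.part x) ∧ y ∉ P.part x ∧ G.Adj x y ∧ ∀ C, ¬ IsCutBy G C x y := by
  classical
  by_cases hex : ∃ C x y, y ∉ P.part x ∧ G.Adj x y ∧ IsCutBy G C x y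
  swap
  · push Not at hex
    obtain ⟨x, hx⟩ := P.nonempty_of_mem_parts hTP
    obtain ⟨y, hy, hxy⟩ := hT.exists_adj_notMem hcubic hx
    rw [← P.part_eq_of_mem hTP hx] at hT hy
    exact ⟨x, y, hT, hy, hxy, fun C => hex C x y hy hxy⟩
  obtain ⟨C, ⟨x, y, hy, hxy, hC⟩, hmin⟩ := exists_minimalFor_of_wellFoundedLT
    (fun C : Finset V => ∃ x y, y ∉ P.part x ∧ G.Adj x y ∧ IsCutBy G C x y) Finset.card hex
  have hcard : ∀ C' : Finset V, (∃ x y, y ∉ P.part x ∧ G.Adj x y ∧ IsCutBy G C' x y) → C' ⊆ C →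
      y ∉ C' → False := by
    intro C' h hsub hyC
    have hlt := Finset.card_lt_card ((Finset.ssubset_iff_of_subset hsub).2 ⟨y, hC.2.1, hyC⟩)
    have := hmin h hlt.le
    omega
  have hU := P.part_mem.2 (Finset.mem_univ y)
  have hyU := P.mem_part (Finset.mem_univ y)
  have hxU : x ∉ P.part y := fun h => hy (by
    rw [P.part_eq_of_mem hU h]; exact hyU)
  -- An edge leaving `C` must end at `x`, which is not in the unit of `y`.
  have hin : ∀ z ∈ P.part y, ∀ w ∈ P.part y, z ∈ C → G.Adj z w → w ∈ C := by
    intro z _ w hw hz hzw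
    by_contra hwC
    exact hxU ((hC.2.2 w z hwC hz hzw.symm).1 ▸ hw)
  rcases hP _ hU with hT | hD
  · obtain ⟨z, hz, hzy⟩ : ∃ z ∈ P.part y, z ≠ y := by
      apply Finset.exists_mem_ne
      rw [hT.card_eq]
      omega
    have hadj : G.Adj z y := (hT.ignites hz hyU hzy).2.1
    have hzC := hin y hyU z hz hC.2.1 hadj.symm
    obtain ⟨w, hw, hzw⟩ := hT.exists_adj_notMem hcubic hz
    have hUz := P.part_eq_of_mem hU hz
    refine ⟨z, w, hUz ▸ hT, hUz ▸ hw, hzw, fun C' hC' => ?_⟩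
    have hyw : y ≠ w := fun h => hw (h ▸ hyU)
    have hyC' : y ∉ C' := fun h => hyw (hC'.2.2 z y hC'.1 h hadj).2
    have hwC : w ∈ C := by
      by_contra hwC
      exact hzy (hC.2.2 w z hwC hzC hzw.symm).2
    -- An edge entering the intersection from inside `C` crosses `C'`, so it is `zw`; one from
    -- outside `C` would be `xy`, but `y ∉ C'`.
    refine hcard (C ∩ C') ⟨z, w, hUz ▸ hw, hzw, ?_, ?_, ?_⟩ Finset.inter_subset_left ?_
    · exact fun h => hC'.1 (Finset.mem_inter.1 h).2
    · exact Finset.mem_inter.2 ⟨hwC, hC'.2.1⟩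
    · intro p q hp hq hpq
      rw [Finset.mem_inter] at hp hq
      by_cases hpC : p ∈ C
      · exact hC'.2.2 p q (fun h => hp ⟨hpC, h⟩) hq.2 hpq
      · exact (hyC' ((hC.2.2 p q hpC hq.1 hpq).2 ▸ hq.2)).elim
    · exact fun h => hyC' (Finset.mem_inter.1 h).2
  · exfalso
    obtain ⟨b, c, d, hyc, hyd, hbc, hbd, hcd, hyb, hne, hUeq⟩ :=
      hD.exists_eq_of_adj_notMem hcubic hyU hxU hxy.symm
    obtain ⟨w, hbw, hwc, hwd⟩ := exists_third_neighbor hcubic b c d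
    have hmem : ∀ z, z ∈ P.part y ↔ z = y ∨ z = b ∨ z = c ∨ z = d := by
      intro z; rw [hUeq]; simp
    have hwU : w ∉ P.part y := by
      rw [hmem]
      rintro (rfl | rfl | rfl | rfl)
      · exact hyb hbw.symm
      · exact hbw.ne rfl
      · exact hwc rfl
      · exact hwd rfl
    have hbU := (hmem b).2 (by simp)
    have hcU := (hmem c).2 (by simp)
    have hcC := hin y hyU c hcU hC.2.1 hyc
    have hbC := hin c hcU b hbU hcC hbc.symm
    have hwC : w ∈ C := by
      by_contra hwC
      exact hne (hC.2.2 w b hwC hbC hbw.symm).2.symm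
    have hUb := P.part_eq_of_mem hU hbU
    -- An edge entering this set must start in the diamond: at `y` the only outer neighbour is `x ∉
    -- C`, `c` and `d` have none, so only `bw` remains.
    refine hcard (C \ P.part y) ⟨b, w, hUb ▸ hwU, hbw, ?_, ?_, ?_⟩ Finset.sdiff_subset ?_
    · simp [hbU]
    · simp [hwC, hwU]
    · intro p q hp hq hpq
      rw [Finset.mem_sdiff] at hp hq
      have hpU : p ∈ P.part y := by
        by_contra hpU
        have hpC : p ∉ C := fun h => hp ⟨h, hpU⟩
        exact hq.2 ((hC.2.2 p q hpC hq.1 hpq).2 ▸ hyU)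
      have hqU := hq.2
      rcases (hmem p).1 hpU with rfl | rfl | rfl | rfl
      · have := eq_of_adj_of_notMem hcubic (Or.inr hD) hyU hxU hqU hxy.symm hpq
        exact (hC.1 (this ▸ hq.1)).elim
      · exact ⟨rfl, (eq_of_adj_of_notMem hcubic (Or.inr hD) hbU hwU hqU hbw hpq).symm⟩
      · have := eq_of_adj_of_three hcubic hyc.symm hbc.symm hcd hne hyd.ne hbd.ne hpq
        exact (hqU ((hmem q).2 (by clear * - this; tauto))).elim
      · have := eq_of_adj_of_three hcubic hyd.symm hbd.symm hcd.symm hne hyc.ne hbc.ne hpq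
        exact (hqU ((hmem q).2 (by clear * - this; tauto))).elim
    · simp [hyU]

/-! ### Lower bounds. -/

theorem IsPercolatingSet.inter_triangle_nonempty [DecidableRel G.Adj]
    (hcubic : G.IsRegularOfDegree 3) {S : Finset V} (hS : IsPercolatingSet G 2 S) {T : Finset V}
    (hT : IsTri G T) : ∃ v ∈ S, v ∈ T := by
  by_contra! h
  have main : ∀ v, Infected G 2 S v → v ∉ T := by
    intro v hv
    induction hv with
    | init v hv => exact h v hv
    | step v W hcard hadj _ ih =>
      intro hvT
      obtain ⟨x, hx, y, hy, hxy, hvx, hvy⟩ := exists_two_neighbors (Or.inl hT) hvT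
      obtain ⟨p, hp, q, hq, hpq⟩ := Finset.one_lt_card.1 hcard
      exact hpq (eq_of_adj_of_notMem hcubic (Or.inl hT) hvT (ih p hp) (ih q hq) (hadj p hp)
        (hadj q hq))
  obtain ⟨a, b, c, -, -, -, rfl⟩ := hT
  exact main a (hS a) (by simp)

theorem IsPercolatingSet.parts_subset_image [DecidableRel G.Adj] (hcubic : G.IsRegularOfDegree 3)
    {P : Finpartition (Finset.univ : Finset V)} (hP : ∀ U ∈ P.parts, IsTri G U ∨ IsDia G U)
    {S : Finset V} (hS : IsPercolatingSet G 2 S) : P.parts ⊆ S.image P.part := by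
  intro U hU
  obtain ⟨T, hTU, hT⟩ := exists_isTri_subset (hP U hU)
  obtain ⟨v, hvS, hvT⟩ := hS.inter_triangle_nonempty hcubic hT
  exact Finset.mem_image.2 ⟨v, hvS, P.part_eq_of_mem hU (hTU hvT)⟩

theorem IsPercolatingSet.card_parts_le [DecidableRel G.Adj] (hcubic : G.IsRegularOfDegree 3)
    {P : Finpartition (Finset.univ : Finset V)} (hP : ∀ U ∈ P.parts, IsTri G U ∨ IsDia G U)
    {S : Finset V} (hS : IsPercolatingSet G 2 S) : P.parts.card ≤ S.card :=
  (Finset.card_le_card (hS.parts_subset_image hcubic hP)).trans Finset.card_image_le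

/-- If all units are diamonds, one infected vertex per unit is not enough. -/
theorem IsPercolatingSet.card_parts_lt [DecidableRel G.Adj] [Nonempty V]
    (hcubic : G.IsRegularOfDegree 3) {P : Finpartition (Finset.univ : Finset V)}
    (hP : ∀ U ∈ P.parts, IsDia G U) {S : Finset V} (hS : IsPercolatingSet G 2 S) :
    P.parts.card < S.card := by
  by_contra! hle
  have hP' : ∀ U ∈ P.parts, IsTri G U ∨ IsDia G U := fun U hU => Or.inr (hP U hU)
  have hsub := hS.parts_subset_image hcubic hP'
  -- Every part contains a seed and there are at most as many seeds as parts, so each part has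
  -- exactly one.
  have hinj : Set.InjOn P.part S := Finset.card_image_iff.1
    (le_antisymm Finset.card_image_le (hle.trans (Finset.card_le_card hsub)))
  have huniq : ∀ {U u v}, U ∈ P.parts → u ∈ U → v ∈ U → u ∈ S → v ∈ S → u = v :=
    fun hU hu hv huS hvS => hinj huS hvS ((P.part_eq_of_mem hU hu).trans (P.part_eq_of_mem hU hv).symm)
  -- a seed has no neighbor outside its unit
  have hclosed : ∀ U ∈ P.parts, ∀ t ∈ U, t ∈ S → ∀ w, G.Adj t w → w ∈ U := by
    intro U hU t htU htS w htw
    obtain ⟨a, b, c, d, hac, had, hbc, hbd, hcd, hab, hne, rfl⟩ := hP U hU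
    -- The seed hits both triangles `acd` and `bcd`.
    have ht : t = c ∨ t = d := by
      obtain ⟨u, huS, hu⟩ := hS.inter_triangle_nonempty hcubic ⟨a, c, d, hac, had, hcd, rfl⟩
      obtain ⟨v, hvS, hv⟩ := hS.inter_triangle_nonempty hcubic ⟨b, c, d, hbc, hbd, hcd, rfl⟩
      have h1 := huniq hU htU (v := u) (by grind) htS huS
      have h2 := huniq hU htU (v := v) (by grind) htS hvS
      subst h1
      subst h2
      simp only [Finset.mem_insert, Finset.mem_singleton] at hu hv
      grind
    rcases ht with rfl | rfl
    · have := eq_of_adj_of_three hcubic hac.symm hbc.symm hcd hne had.ne hbd.ne htw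
      grind
    · have := eq_of_adj_of_three hcubic had.symm hbd.symm hcd.symm hne hac.ne hbc.ne htw
      grind
  -- Two infected neighbours of `v` would be seeds of the unit of `v`, hence equal; no infection
  -- step ever occurs.
  have main : ∀ v, Infected G 2 S v → v ∈ S := by
    intro v hv
    induction hv with
    | init v hv => exact hv
    | step v W hcard hadj _ ih =>
      obtain ⟨p, hp, q, hq, hpq⟩ := Finset.one_lt_card.1 hcard
      have hmem : ∀ u ∈ W, u ∈ P.part v := by
        intro u hu
        have hU := P.part_mem.2 (Finset.mem_univ u)
        have huU := P.mem_part (Finset.mem_univ u)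
        have := hclosed _ hU u huU (ih u hu) v (hadj u hu).symm
        rwa [P.part_eq_of_mem hU this]
      exact (hpq (huniq (P.part_mem.2 (Finset.mem_univ v)) (hmem p hp) (hmem q hq) (ih p hp)
        (ih q hq))).elim
  obtain ⟨v⟩ := ‹Nonempty V›
  have hU := P.part_mem.2 (Finset.mem_univ v)
  have hall : ∀ u w, u ∈ P.part v → w ∈ P.part v → u = w := fun u w hu hw =>
    huniq hU hu hw (main u (hS u)) (main w (hS w))
  have := (hP _ hU).card_eq
  have h2 := Finset.card_le_one.2 fun u hu w hw => hall u w hu hw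
  omega

end Spread

theorem percolationNumber_eq {r n : ℕ} {S : Finset V} (hS : IsPercolatingSet G r S)
    (hle : S.card ≤ n) (hlow : ∀ S', IsPercolatingSet G r S' → n ≤ S'.card) :
    percolationNumber G r = n := by
  have hn : S.card = n := le_antisymm hle (hlow S hS)
  refine le_antisymm (Nat.sInf_le ⟨S, hS, hn⟩) ?_
  refine le_csInf ⟨_, S, hS, rfl⟩ ?_
  rintro _ ⟨S', hS', rfl⟩
  exact hlow S' hS'

/-! ### Necklaces are exactly the graphs whose units are all diamonds. -/

/-- In a dihedral action of two fixed-point-free involutions, opposite orientations never meet. -/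
theorem iterate_comp_ne {X : Type*} {σ τ : X → X} (hσ : Function.Involutive σ)
    (hτ : Function.Involutive τ) (hσ' : ∀ x, σ x ≠ x) (hτ' : ∀ x, τ x ≠ x) (i j : ℕ) (x : X) :
    (σ ∘ τ)^[i] x ≠ τ ((σ ∘ τ)^[j] x) := by
  have base : ∀ n, ∀ x, (σ ∘ τ)^[n] x ≠ τ x := by
    intro n
    induction n using Nat.twoStepInduction with
    | zero => exact fun x h => hτ' x h.symm
    | one => exact fun x h => hσ' (τ x) h
    | more n ih _ =>
      intro x h
      -- Applying `τ ∘ σ` to the equation for `n + 2` at `x` gives the equation for `n` at `σ (τ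
      -- x)`.
      refine ih ((σ ∘ τ) x) ?_
      rw [Function.iterate_succ_apply, Function.iterate_succ_apply',
        Function.comp_apply (f := σ)] at h
      have h' := congrArg (τ ∘ σ) h
      simp only [Function.comp_apply, hσ (τ _), hτ _] at h'
      exact h'
  induction j generalizing i with
  | zero => exact base i x
  | succ j ih =>
    intro h
    refine ih (i + 1) ?_
    rw [Function.iterate_succ_apply', h, Function.iterate_succ_apply']
    simp only [Function.comp_apply]
    rw [hτ (σ _), hσ (τ _)]

section Necklace

variable [Fintype V] [DecidableEq V] [DecidableRel G.Adj]

theorem IsDiamondNecklace.isDia_of_isUnitSet (hG : IsDiamondNecklace G) (hconn : G.Connected)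
    (hcubic : G.IsRegularOfDegree 3) (hK4 : ¬ Nonempty (G ≃g (⊤ : SimpleGraph (Fin 4))))
    {U : Finset V} (hU : IsUnitSet G U) {v : V} (hv : v ∈ U) : IsDia G U := by
  obtain ⟨k, hk, ⟨φ⟩⟩ := hG
  have hadj : ∀ p q, G.Adj (φ.symm p) (φ.symm q) ↔ (diamondNecklace k).Adj p q :=
    fun p q => φ.symm.map_adj_iff
  have hin : ∀ i j j', diamond.Adj j j' → G.Adj (φ.symm (i, j)) (φ.symm (i, j')) :=
    fun i j j' h => (hadj _ _).2 (Or.inl ⟨rfl, h⟩)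
  simp only [diamond_adj] at hin
  set i := (φ v).1 with hi
  have hD : IsDia G {φ.symm (i, 0), φ.symm (i, 1), φ.symm (i, 2), φ.symm (i, 3)} := by
    refine ⟨_, _, _, _, hin _ _ _ (by decide), hin _ _ _ (by decide), hin _ _ _ (by decide),
      hin _ _ _ (by decide), hin _ _ _ (by decide), ?_, ?_, rfl⟩
    · rw [hadj]
      -- This needs `k ≥ 2`: for `k = 1` the linking edge would fill in the missing edge of the
      -- diamond.
      have hone : i ≠ i + 1 := by
        intro h
        have : Fact (1 < k) := ⟨hk⟩
        exact one_ne_zero (left_eq_add.1 h)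
      rintro (⟨-, h⟩ | ⟨h, -⟩ | ⟨h, -⟩)
      · simp [diamond_adj] at h
      · exact hone h
      · exact hone h
    · intro h
      simpa using φ.symm.injective h
  have hvD : v ∈ ({φ.symm (i, 0), φ.symm (i, 1), φ.symm (i, 2), φ.symm (i, 3)} : Finset V) := by
    have : ∀ j, φ v = (i, j) → v = φ.symm (i, j) := fun j h => by rw [← h]; simp
    have h2 : φ v = (i, (φ v).2) := rfl
    simp only [Finset.mem_insert, Finset.mem_singleton]
    generalize (φ v).2 = j at h2
    have := this j h2
    fin_cases j
    · exact Or.inl this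
    · exact Or.inr (Or.inl this)
    · exact Or.inr (Or.inr (Or.inl this))
    · exact Or.inr (Or.inr (Or.inr this))
  rw [hU.eq_of_meet hconn hcubic hK4 (Or.inl hD) hv hvD]
  exact hD

/-- `v` has a neighbor outside its part. -/
def IsPort (G : SimpleGraph V) (P : Finpartition (Finset.univ : Finset V)) (v : V) : Prop :=
  ∃ e, G.Adj v e ∧ e ∉ P.part v

theorem exists_adj_notMem_of_dia (hcubic : G.IsRegularOfDegree 3) {a b c d : V}
    (hab : ¬ G.Adj a b) : ∃ e, G.Adj a e ∧ e ∉ ({a, b, c, d} : Finset V) := by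
  obtain ⟨e, hae, hec, hed⟩ := exists_third_neighbor hcubic a c d
  refine ⟨e, hae, ?_⟩
  simp only [Finset.mem_insert, Finset.mem_singleton]
  rintro (rfl | rfl | rfl | rfl)
  · exact hae.ne rfl
  · exact hab hae
  · exact hec rfl
  · exact hed rfl

/-- The ports of a diamond are the two ends of its missing edge, as the other two vertices have all
neighbours inside. -/
theorem IsPort.exists_opposite (hcubic : G.IsRegularOfDegree 3)
    {P : Finpartition (Finset.univ : Finset V)} (hP : ∀ U ∈ P.parts, IsDia G U) {v : V}
    (hv : IsPort G P v) : ∃ b c d, IsPort G P b ∧ G.Adj v c ∧ G.Adj v d ∧ G.Adj b c ∧ G.Adj b d ∧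
      G.Adj c d ∧ v ≠ b ∧ P.part v = {v, b, c, d} ∧
      ∀ u ∈ P.part v, IsPort G P u → u = v ∨ u = b := by
  obtain ⟨e, hve, he⟩ := hv
  have hU := P.part_mem.2 (Finset.mem_univ v)
  obtain ⟨b, c, d, hvc, hvd, hbc, hbd, hcd, hvb, hne, heq⟩ :=
    (hP _ hU).exists_eq_of_adj_notMem hcubic (P.mem_part (Finset.mem_univ v)) he hve
  have hpart : ∀ u ∈ ({v, b, c, d} : Finset V), P.part u = {v, b, c, d} := by
    intro u hu
    rw [← heq] at hu ⊢
    exact P.part_eq_of_mem hU hu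
  refine ⟨b, c, d, ?_, hvc, hvd, hbc, hbd, hcd, hne, heq, ?_⟩
  · rw [IsPort, hpart b (by simp), Finset.insert_comm]
    exact exists_adj_notMem_of_dia hcubic fun h => hvb h.symm
  · intro u hu ⟨e', hue, he'⟩
    rw [heq] at hu
    rw [hpart u hu] at he'
    simp only [Finset.mem_insert, Finset.mem_singleton] at hu he'
    rcases hu with rfl | rfl | rfl | rfl
    · exact Or.inl rfl
    · exact Or.inr rfl
    · have := eq_of_adj_of_three hcubic hvc.symm hbc.symm hcd hne hvd.ne hbd.ne hue
      exact (he' (by clear * - this; tauto)).elim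
    · have := eq_of_adj_of_three hcubic hvd.symm hbd.symm hcd.symm hne hvc.ne hbc.ne hue
      exact (he' (by clear * - this; tauto)).elim

/-- Each necklace vertex has three neighbours, whose images exhaust the neighbours of its image.
Hence the image is closed under adjacency and no extra edges occur. -/
theorem isDiamondNecklace_of_hom (hconn : G.Connected) (hcubic : G.IsRegularOfDegree 3) {k : ℕ}
    (hk : 2 ≤ k) {f : ZMod k × Fin 4 → V} (hf : Function.Injective f)
    (hadj : ∀ x y, (diamondNecklace k).Adj x y → G.Adj (f x) (f y)) : IsDiamondNecklace G := by
  have key : ∀ x w, G.Adj (f x) w → ∃ y, (diamondNecklace k).Adj x y ∧ f y = w := by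
    intro x w hw
    have main : ∀ y₁ y₂ y₃, (diamondNecklace k).Adj x y₁ → (diamondNecklace k).Adj x y₂ →
        (diamondNecklace k).Adj x y₃ → y₁ ≠ y₂ → y₁ ≠ y₃ → y₂ ≠ y₃ →
        ∃ y, (diamondNecklace k).Adj x y ∧ f y = w := by
      intro y₁ y₂ y₃ h1 h2 h3 h12 h13 h23
      rcases eq_of_adj_of_three hcubic (hadj _ _ h1) (hadj _ _ h2) (hadj _ _ h3) (hf.ne h12)
        (hf.ne h13) (hf.ne h23) hw with h | h | h
      · exact ⟨_, h1, h.symm⟩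
      · exact ⟨_, h2, h.symm⟩
      · exact ⟨_, h3, h.symm⟩
    obtain ⟨i, j⟩ := x
    have hin : ∀ j', diamond.Adj j j' → (diamondNecklace k).Adj (i, j) (i, j') :=
      fun j' h => Or.inl ⟨rfl, h⟩
    simp only [diamond_adj] at hin
    fin_cases j
    · exact main (i, 2) (i, 3) (i + 1, 1) (hin _ (by decide)) (hin _ (by decide))
        (Or.inr (Or.inl ⟨rfl, rfl, rfl⟩)) (by simp) (by simp) (by simp)
    · exact main (i, 2) (i, 3) (i - 1, 0) (hin _ (by decide)) (hin _ (by decide))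
        (Or.inr (Or.inr ⟨by simp, rfl, rfl⟩)) (by simp) (by simp) (by simp)
    · exact main (i, 0) (i, 1) (i, 3) (hin _ (by decide)) (hin _ (by decide)) (hin _ (by decide))
        (by simp) (by simp) (by simp)
    · exact main (i, 0) (i, 1) (i, 2) (hin _ (by decide)) (hin _ (by decide)) (hin _ (by decide))
        (by simp) (by simp) (by simp)
  have hsurj : Function.Surjective f := by
    refine mem_of_closed hconn (C := Set.range f) (r := f (0, 0)) ⟨_, rfl⟩ ?_
    rintro _ w ⟨x, rfl⟩ hw
    obtain ⟨y, -, rfl⟩ := key x w hw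
    exact ⟨y, rfl⟩
  refine ⟨k, hk, ⟨SimpleGraph.Iso.symm ⟨Equiv.ofBijective f ⟨hf, hsurj⟩, ?_⟩⟩⟩
  intro x y
  change G.Adj (f x) (f y) ↔ _
  refine ⟨fun h => ?_, hadj x y⟩
  obtain ⟨z, hz, hzy⟩ := key x _ h
  rwa [← hf hzy]

theorem isDiamondNecklace_of_forall_isDia (hconn : G.Connected) (hcubic : G.IsRegularOfDegree 3)
    {P : Finpartition (Finset.univ : Finset V)} (hP : ∀ U ∈ P.parts, IsDia G U) :
    IsDiamondNecklace G := by
  have hpart : ∀ {u v}, u ∈ P.part v → P.part u = P.part v :=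
    fun h => P.part_eq_of_mem (P.part_mem.2 (Finset.mem_univ _)) h
  have hself : ∀ v, v ∈ P.part v := fun v => P.mem_part (Finset.mem_univ v)
  obtain ⟨p₀⟩ : Nonempty {v // IsPort G P v} := by
    obtain ⟨v⟩ := hconn.nonempty
    have hU := P.part_mem.2 (Finset.mem_univ v)
    obtain ⟨a, b, c, d, hac, had, hbc, hbd, hcd, hab, hne, heq⟩ := hP _ hU
    refine ⟨a, ?_⟩
    have ha : a ∈ P.part v := by rw [heq]; simp
    rw [IsPort, hpart ha, heq]
    exact exists_adj_notMem_of_dia hcubic hab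
  have hσ : ∀ v : {v // IsPort G P v}, ∃ e : {v // IsPort G P v},
      G.Adj v e ∧ (e : V) ∉ P.part (v : V) := by
    rintro ⟨v, e, hve, he⟩
    refine ⟨⟨e, v, hve.symm, fun h => he ?_⟩, hve, he⟩
    rw [hpart h]
    exact hself e
  have hτ : ∀ v : {v // IsPort G P v}, ∃ b : {v // IsPort G P v}, ∃ c d : V, G.Adj v c ∧ G.Adj v d ∧
      G.Adj b c ∧ G.Adj b d ∧ G.Adj c d ∧ v ≠ b ∧ P.part (v : V) = {(v : V), (b : V), c, d} ∧
      ∀ u : {v // IsPort G P v}, (u : V) ∈ P.part (v : V) → u = v ∨ u = b := by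
    rintro ⟨v, hv⟩
    obtain ⟨b, c, d, hb, hvc, hvd, hbc, hbd, hcd, hne, heq, hu⟩ := hv.exists_opposite hcubic hP
    refine ⟨⟨b, hb⟩, c, d, hvc, hvd, hbc, hbd, hcd, fun h => hne (congrArg Subtype.val h), heq, ?_⟩
    rintro ⟨u, hu'⟩ huv
    simpa using hu u huv hu'
  choose σ hσadj hσpart using hσ
  choose τ c d hc hd hτc hτd hcd hτne hτpart hτu using hτ
  have hτmem : ∀ v : {v // IsPort G P v}, (τ v : V) ∈ P.part (v : V) := fun v => by rw [hτpart]; simp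
  have hττ : Function.Involutive τ := by
    intro v
    have h1 : (τ (τ v) : V) ∈ P.part (v : V) := by
      rw [← hpart (hτmem v)]
      exact hτmem _
    rcases hτu v _ h1 with h | h
    · exact h
    · exact (hτne (τ v) h.symm).elim
  have hσσ : Function.Involutive σ := by
    intro v
    have hnot : (v : V) ∉ P.part (σ v : V) := fun h => hσpart v (by rw [hpart h]; exact hself _)
    exact Subtype.ext (eq_of_adj_of_notMem hcubic
      (Or.inr (hP _ (P.part_mem.2 (Finset.mem_univ (σ v : V))))) (hself _) (hσpart _) hnot
      (hσadj _) (hσadj v).symm)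
  have hσne : ∀ v, σ v ≠ v := fun v h => hσpart v (by rw [h]; exact hself _)
  -- Here `τ` crosses a diamond to its opposite port and `σ` follows the outer edge; the orbit of
  -- `p₀` under `f` walks around the necklace.
  set f := σ ∘ τ with hf
  set k := Function.minimalPeriod f p₀ with hkdef
  have hk0 : 0 < k := Function.minimalPeriod_pos_of_mem_periodicPts
    ((hσσ.injective.comp hττ.injective).mem_periodicPts p₀)
  -- Period 1 would make `σ` join two ports of the same diamond.
  have hk1 : k ≠ 1 := by
    intro h
    have h1 : f^[k] p₀ = p₀ := Function.iterate_minimalPeriod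
    rw [h, Function.iterate_one] at h1
    refine hσpart (τ p₀) ?_
    have h2 : σ (τ p₀) = p₀ := h1
    rw [h2, hpart (hτmem p₀)]
    exact hself _
  have : NeZero k := ⟨hk0.ne'⟩
  let p : ZMod k → {v // IsPort G P v} := fun i => f^[i.val] p₀
  have hpsucc : ∀ i, p (i + 1) = σ (τ (p i)) := by
    intro i
    have h1 : ∀ n : ℕ, p n = f^[n] p₀ := fun n => by
      change f^[(n : ZMod k).val] p₀ = _
      rw [ZMod.val_natCast, hkdef, Function.iterate_mod_minimalPeriod_eq]
    have h2 := h1 (i.val + 1)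
    rw [Nat.cast_add, ZMod.natCast_zmod_val, Nat.cast_one, Function.iterate_succ_apply'] at h2
    exact h2
  -- A port in the diamond of `p i` is `p i` or `τ (p i)`; the orbit never returns in the opposite
  -- orientation, by `iterate_comp_ne`.
  have hpinj : ∀ i j, (p j : V) ∈ P.part (p i : V) → i = j := by
    intro i j h
    rcases hτu _ _ h with h | h
    · exact ZMod.val_injective k (((Function.iterate_eq_iterate_iff_of_lt_minimalPeriod
        (ZMod.val_lt j) (ZMod.val_lt i)).1 h).symm)
    · exact (iterate_comp_ne hσσ hττ hσne (fun v h => hτne v h.symm) _ _ p₀ h).elim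
  -- The walk enters a diamond at `p i`, which plays `b_i`, and leaves at `τ (p i)`, which plays
  -- `a_i`.
  let g : ZMod k × Fin 4 → V := fun x =>
    ![(τ (p x.1) : V), (p x.1 : V), c (p x.1), d (p x.1)] x.2
  have hgmem : ∀ x, g x ∈ P.part (p x.1 : V) := by
    rintro ⟨i, j⟩
    rw [hτpart]
    fin_cases j <;> simp [g]
  have hdia : ∀ i j j', diamond.Adj j j' → G.Adj (g (i, j)) (g (i, j')) := by
    intro i j j' h
    rw [diamond_adj] at h
    have h1 := hc (p i); have h2 := hd (p i); have h3 := hτc (p i); have h4 := hτd (p i)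
    have h5 := hcd (p i)
    fin_cases j <;> fin_cases j' <;>
      first
      | exact absurd h (by decide)
      | assumption
      | (apply SimpleGraph.Adj.symm; assumption)
  have hnext : ∀ i, G.Adj (g (i, 0)) (g (i + 1, 1)) := by
    intro i
    change G.Adj (τ (p i) : V) (p (i + 1) : V)
    rw [hpsucc]
    exact hσadj _
  refine isDiamondNecklace_of_hom hconn hcubic (by omega) (f := g) ?_ ?_
  · rintro ⟨i, j⟩ ⟨i', j'⟩ h
    have h1 := hgmem (i, j)
    have h2 := hgmem (i', j')
    rw [← h] at h2
    have h3 := (hpart h1).symm.trans (hpart h2)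
    have hii : i = i' := hpinj _ _ (by rw [h3]; exact hself _)
    subst hii
    by_contra hne
    have hjj : j ≠ j' := fun h => hne (by rw [h])
    by_cases hadj : diamond.Adj j j'
    · exact (hdia i j j' hadj).ne h
    · rw [diamond_adj] at hadj
      have h4 : (j = 0 ∧ j' = 1) ∨ (j = 1 ∧ j' = 0) := by clear * - hadj hjj; tauto
      rcases h4 with ⟨rfl, rfl⟩ | ⟨rfl, rfl⟩
      · exact hτne (p i) (Subtype.ext h.symm)
      · exact hτne (p i) (Subtype.ext h)
  · rintro ⟨i, j⟩ ⟨i', j'⟩ (⟨h, h'⟩ | ⟨h, h', h''⟩ | ⟨h, h', h''⟩) <;> dsimp only at h h' <;> subst h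
    · exact hdia _ _ _ h'
    · dsimp only at h''
      subst h' h''
      exact hnext _
    · dsimp only at h''
      subst h' h''
      exact (hnext _).symm

end Necklace

end SpreadingGraphs

theorem theorem3 {V : Type*} [Fintype V] [DecidableEq V] (G : SimpleGraph V) [DecidableRel G.Adj]
    (hconn : G.Connected) (hclaw : SpreadingGraphs.IsClawFree G)
    (hcubic : G.IsRegularOfDegree 3)
    (hK4 : ¬ Nonempty (G ≃g (⊤ : SimpleGraph (Fin 4)))) :
    (∃! P : Finpartition (Finset.univ : Finset V),
      SpreadingGraphs.IsTriangleDiamondPartition G P) ∧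
    ∀ P : Finpartition (Finset.univ : Finset V),
      SpreadingGraphs.IsTriangleDiamondPartition G P →
        (SpreadingGraphs.IsDiamondNecklace G →
          SpreadingGraphs.percolationNumber G 2 = P.parts.card + 1) ∧
        (¬ SpreadingGraphs.IsDiamondNecklace G →
          SpreadingGraphs.percolationNumber G 2 = P.parts.card) := by
  open SpreadingGraphs in
  refine ⟨existsUnique_partition hconn hclaw hcubic hK4, fun P hTD => ?_⟩
  have hP := (isTriangleDiamondPartition_iff P).1 hTD
  have := hconn.nonempty
  constructor
  · intro hN
    have hD : ∀ U ∈ P.parts, IsDia G U := fun U hU => by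
      obtain ⟨v, hv⟩ := P.nonempty_of_mem_parts hU
      exact hN.isDia_of_isUnitSet hconn hcubic hK4 (isUnitSet_of_mem_parts hcubic hP hU) hv
    obtain ⟨S, hS, hcard⟩ := exists_percolatingSet_card_le_succ hconn hP
    exact percolationNumber_eq hS hcard fun S' hS' => hS'.card_parts_lt hcubic hD
  · intro hN
    have hT : ∃ T ∈ P.parts, IsTri G T := by
      by_contra! h
      exact hN (isDiamondNecklace_of_forall_isDia hconn hcubic
        fun U hU => (hP U hU).resolve_left (h U hU))
    obtain ⟨T, hTP, hT⟩ := hT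
    obtain ⟨x, y, hx, hy, hxy, hcut⟩ := exists_not_isCutBy hcubic hP hTP hT
    obtain ⟨S, hS, hcard⟩ := exists_percolatingSet_card_le hconn hcubic hP hx hy hxy hcut
    exact percolationNumber_eq hS hcard fun S' hS' => hS'.card_parts_le hcubic hP
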